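/- Let $n\in\{2,3\}$, let $\Omega\subset\mathbb R^n$ be open, bounded and convex, and let $a_{ij},c_0\in L^\infty(\Omega)$ with $c_0\ge 0$ a.e., $a_{ij}=a_{ji}$ and $\sum_{i,j}a_{ij}(x)\xi_i\xi_j\ge\theta\|\xi\|^2$ for a.e. $x\in\Omega$ and all $\xi\in\mathbb R^n$, for some $\theta>0$. Put $a(y,v)=\int_\Omega\big(\sum_{i,j}a_{ji}\,y_{x_i}v_{x_j}+c_0yv\big)\,dx$. Let $\alpha,\kappa,\tau>0$. Consider conforming simplicial triangulations $\mathcal T_h$ with finitely many cells, such that the interior $\Omega_h$ of the union of the cells is contained in $\Omega$. Write $\rho_T=\operatorname{diam}T$, let $\sigma_T$ be the diameter of the largest ball contained in the cell $T$, let $h=\max_{T\in\mathcal T_h}\rho_T$, and suppose that $$\frac{\rho_T}{\sigma_T}\le\kappa,\qquad \frac{h}{\rho_T}\le\tau\qquad\text{for all }T\in\mathcal T_h .$$ Let $x_1,\dots,x_{N_h}$ be the nodes, that is, the vertices of $\mathcal T_h$ lying in $\Omega_h$ (piecewise linear functions vanishing outside $\Omega_h$) or, alternatively, all vertices of $\mathcal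 T_h$. Let $\phi_1,\dots,\phi_{N_h}$ be the nodal basis functions: $\phi_i$ is affine on each cell, equals $1$ at $x_i$ and $0$ at all other vertices, and is extended by zero outside the union of the cells. (Derivatives of $\phi_i$ are understood almost everywhere.) Put $$K_h=\big(a(\phi_i,\phi_j)\big)_{i,j},\quad M_h=\Big(\int_{\Omega_h}\phi_i\phi_j\,dx\Big)_{i,j},\quad W_h=\operatorname{diag}\Big(\int_{\Omega_h}\phi_i\,dx\Big)_i,\quad G_h=M_h+\alpha K_hM_h^{-1}K_h,$$ and, with $\gamma=4$ if $n=2$ and $\gamma=5$ if $n=3$, $$\mathcal S_h=\frac1\alpha\begin{pmatrix}M_hG_h^{-1}M_h+W_h-M_h&0&0\\0&0&0\\0&0&\gamma M_hW_h^{-1}M_h\end{pmatrix}.$$ Then there exist positive constants $l_1,l_2,u_1,u_2,C$ and $h_0$, depending only on $n,\Omega,(a_{ij}),c_0,\alpha,\kappa,\tau$, such that for every such triangulation with $0<h<h_0$ and every $0\ne\mathbf x\in\mathbb R^{N_h}$ $$l_1h^2\le\frac{\mathbf x^TG_h\mathbf x}{\mathbf x^T\mathbf x}\le u_1\frac1{h^2}\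 \text{ if } n=2,\qquad l_2h^3\le\frac{\mathbf x^TG_h\mathbf x}{\mathbf x^T\mathbf x}\le u_2\frac1h\ \text{ if } n=3 .$$ Moreover, for every such triangulation with $0<h<h_0$ and $N_h\ge1$, the largest eigenvalues $\lambda_{\max}(M_hG_h^{-1}M_h)$ and $\lambda_{\max}(\mathcal S_h)$ exist, and both are at most $Ch^2$ in absolute value if $n=2$ and at most $Ch^3$ in absolute value if $n=3$. -/

import Mathlib

open MeasureTheory Set

noncomputable section

namespace FEM

/-- Euclidean space `ℝⁿ`. -/
abbrev E (n : ℕ) : Type := EuclideanSpace ℝ (Fin n)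

/-! ### Triangulations -/

/-- A (conforming, finite) triangulation in `ℝⁿ`: a finite simplicial complex all of whose
simplices are faces of `n`-dimensional simplices. A simplex is given by its vertex set. -/
structure Triangulation (n : ℕ) where
  complex : Geometry.SimplicialComplex ℝ (E n)
  finite : complex.faces.Finite
  pure : ∀ s ∈ complex.faces, ∃ t ∈ complex.faces, s ⊆ t ∧ t.card = n + 1

/-- The closed simplex with the given vertices. -/
def simplex {n : ℕ} (T : Finset (E n)) : Set (E n) := convexHull ℝ (T : Set (E n))

/-- `ρ_T`, the diameter of the simplex `T`. -/
def rho {n : ℕ} (T : Finset (E n)) : ℝ := Metric.diam (simplex T)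

/-- `σ_T`, the diameter of the largest ball contained in the simplex `T`. -/
def sigma {n : ℕ} (T : Finset (E n)) : ℝ :=
  sSup {d : ℝ | 0 ≤ d ∧ ∃ p : E n, Metric.closedBall p (d / 2) ⊆ simplex T}

namespace Triangulation

variable {n : ℕ} (𝒯 : Triangulation n)

/-- The cells of a triangulation: its `n`-dimensional simplices. -/
def cells : Set (Finset (E n)) := {T | T ∈ 𝒯.complex.faces ∧ T.card = n + 1}

/-- The mesh size `h = max_T ρ_T`. -/
def meshSize : ℝ := sSup (rho '' 𝒯.cells)

/-- `Ω_h`: the interior of the union of the cells. -/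
def domain : Set (E n) := interior (⋃ T ∈ 𝒯.cells, simplex T)

/-- Regularity and quasi-uniformity, with constants `κ` and `τ`. -/
def IsRegularQuasiUniform (κ τ : ℝ) : Prop :=
  ∀ T ∈ 𝒯.cells, rho T / sigma T ≤ κ ∧ 𝒯.meshSize / rho T ≤ τ

/-- All vertices of the triangulation. -/
def vertices : Set (E n) := 𝒯.complex.vertices

/-- The vertices that are not on the boundary of `Ω_h`: the nodes of the space of continuous
piecewise linear functions vanishing outside `Ω_h`. -/
def interiorVertices : Set (E n) := {v | v ∈ 𝒯.vertices ∧ v ∈ 𝒯.domain}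

/-! ### Nodal basis functions -/

/-- `w` is the family of barycentric coordinates of the point `p` with respect to the vertices of
some cell that contains `p`, extended by `0` to all other points. -/
def IsBarycentric (p : E n) (w : E n → ℝ) : Prop :=
  ∃ T ∈ 𝒯.cells, (∀ v ∈ T, 0 ≤ w v) ∧ (∀ v, v ∉ T → w v = 0) ∧
    ∑ v ∈ T, w v = 1 ∧ ∑ v ∈ T, w v • v = p

open scoped Classical in
/-- The nodal basis ("hat") function of the vertex `v`: on each cell it is the barycentric
coordinate belonging to `v` (zero if `v` is not a vertex of the cell), and it vanishes outside the
union of the cells. -/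
def hat (v p : E n) : ℝ :=
  if h : ∃ w, 𝒯.IsBarycentric p w then h.choose v else 0

/-- Barycentric coordinates do not depend on the cell that is used to compute them. -/
theorem IsBarycentric.unique {p : E n} {w w' : E n → ℝ}
    (h : 𝒯.IsBarycentric p w) (h' : 𝒯.IsBarycentric p w') : w = w' := by
  classical
  obtain ⟨S, hS, hS0, hSz, hS1, hSp⟩ := h
  obtain ⟨T, hT, hT0, hTz, hT1, hTp⟩ := h'
  have hmem : p ∈ convexHull ℝ ((S ∩ T : Finset (E n)) : Set (E n)) := by
    rw [Finset.coe_inter]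
    refine 𝒯.complex.inter_subset_convexHull hS.1 hT.1 ⟨?_, ?_⟩
    · exact Finset.mem_convexHull'.2 ⟨w, hS0, hS1, hSp⟩
    · exact Finset.mem_convexHull'.2 ⟨w', hT0, hT1, hTp⟩
  obtain ⟨u, -, hu1, hup⟩ := Finset.mem_convexHull'.1 hmem
  -- an affine combination of the vertices of one cell determines its coefficients
  have key : ∀ R ∈ 𝒯.cells, S ∩ T ⊆ R → ∀ f : E n → ℝ, (∀ v, v ∉ R → f v = 0) →
      ∑ v ∈ R, f v = 1 → ∑ v ∈ R, f v • v = p →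
      f = fun v => if v ∈ S ∩ T then u v else 0 := by
    intro R hR hsub f hfz hf1 hfp
    have hind := (affineIndependent_iff.1 (𝒯.complex.indep hR.1)) Finset.univ
      (fun v => f v - if (v : E n) ∈ S ∩ T then u v else 0)
    have e1 : ∑ v ∈ R, (if v ∈ S ∩ T then u v else 0) = 1 := by
      rw [← Finset.sum_filter, Finset.filter_mem_eq_inter, Finset.inter_eq_right.2 hsub, hu1]
    have e2 : ∑ v ∈ R, (if v ∈ S ∩ T then u v else 0) • v = p := by
      simp only [ite_smul, zero_smul]
      rw [← Finset.sum_filter, Finset.filter_mem_eq_inter, Finset.inter_eq_right.2 hsub, hup]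
    have h1 : ∑ v ∈ R, (f v - if v ∈ S ∩ T then u v else 0) = 0 := by
      rw [Finset.sum_sub_distrib, hf1, e1, sub_self]
    have h2 : ∑ v ∈ R, (f v - if v ∈ S ∩ T then u v else 0) • v = 0 := by
      simp only [sub_smul]
      rw [Finset.sum_sub_distrib, hfp, e2, sub_self]
    rw [← Finset.sum_coe_sort] at h1 h2
    have h3 := hind h1 h2
    funext v
    by_cases hv : v ∈ R
    · exact sub_eq_zero.1 (h3 ⟨v, hv⟩ (Finset.mem_univ _))
    · rw [hfz v hv, if_neg fun hv' => hv (hsub hv')]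
  rw [key S hS Finset.inter_subset_left w hSz hS1 hSp,
    key T hT Finset.inter_subset_right w' hTz hT1 hTp]

/-- On every cell, `hat v` is the barycentric coordinate of `v`. -/
theorem hat_eq {p : E n} {w : E n → ℝ} (h : 𝒯.IsBarycentric p w) (v : E n) :
    𝒯.hat v p = w v := by
  have hex : ∃ w, 𝒯.IsBarycentric p w := ⟨w, h⟩
  rw [hat, dif_pos hex, IsBarycentric.unique 𝒯 hex.choose_spec h]

open scoped Classical in
/-- `φ_i (x_j) = δ_{ij}`. -/
theorem hat_vertex {v q : E n} (hq : q ∈ 𝒯.vertices) :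
    𝒯.hat v q = if v = q then 1 else 0 := by
  obtain ⟨T, hT, hsub, hcard⟩ := 𝒯.pure _ hq
  have hqT : q ∈ T := hsub (Finset.mem_singleton_self q)
  have h : 𝒯.IsBarycentric q (fun v => if v = q then 1 else 0) := by
    refine ⟨T, ⟨hT, hcard⟩, fun v _ => ?_, fun v hv => ?_, ?_, ?_⟩
    · dsimp only
      split_ifs <;> norm_num
    · have hne : v ≠ q := fun e => hv (by rw [e]; exact hqT)
      simp [hne]
    · simp [hqT]
    · simp [hqT]
  exact hat_eq 𝒯 h v

/-! ### Matrices of the finite element discretization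

Throughout, `x : Fin N → ℝⁿ` enumerates the nodes. -/

variable {N : ℕ} (x : Fin N → E n)

/-- The mass matrix `M_h = (∫_{Ω_h} φ_i φ_j)`. -/
def massMatrix : Matrix (Fin N) (Fin N) ℝ :=
  Matrix.of fun i j => ∫ p in 𝒯.domain, 𝒯.hat (x i) p * 𝒯.hat (x j) p

/-- The lumped mass matrix `W_h = diag (∫_{Ω_h} φ_i)`. -/
def lumpedMassMatrix : Matrix (Fin N) (Fin N) ℝ :=
  Matrix.diagonal fun i => ∫ p in 𝒯.domain, 𝒯.hat (x i) p

end Triangulation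

/-- The partial derivative `y_{x_k}`. (For continuous piecewise linear functions the weak
derivative is the classical derivative, which exists almost everywhere.) -/
def pderiv {n : ℕ} (k : Fin n) (y : E n → ℝ) (p : E n) : ℝ :=
  fderiv ℝ y p (EuclideanSpace.single k 1)

/-- The bilinear form `a(y,v) = ∫_Ω (∑_{k,l} a_{lk} y_{x_k} v_{x_l} + c₀ y v)`. -/
def bilinForm {n : ℕ} (Ω : Set (E n)) (a : Fin n → Fin n → E n → ℝ) (c₀ : E n → ℝ)
    (y v : E n → ℝ) : ℝ :=
  ∫ p in Ω, ((∑ k, ∑ l, a l k p * pderiv k y p * pderiv l v p) + c₀ p * y p * v p)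

/-- Assumptions on the coefficients of `L y = -∑ ∂_{x_j} (a_{ij} y_{x_i}) + c₀ y` on `Ω`: bounded
measurable, symmetric, uniformly elliptic with constant `θ`, and `c₀ ≥ 0`. -/
structure IsElliptic {n : ℕ} (Ω : Set (E n)) (a : Fin n → Fin n → E n → ℝ) (c₀ : E n → ℝ)
    (θ : ℝ) : Prop where
  memLp_a : ∀ i j, MemLp (a i j) ⊤ (volume.restrict Ω)
  memLp_c₀ : MemLp c₀ ⊤ (volume.restrict Ω)
  c₀_nonneg : ∀ᵐ p ∂(volume.restrict Ω), 0 ≤ c₀ p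
  symm : ∀ᵐ p ∂(volume.restrict Ω), ∀ i j, a i j p = a j i p
  theta_pos : 0 < θ
  elliptic : ∀ᵐ p ∂(volume.restrict Ω), ∀ ξ : E n,
    θ * ‖ξ‖ ^ 2 ≤ ∑ i, ∑ j, a i j p * ξ i * ξ j

namespace Triangulation

variable {n : ℕ} (𝒯 : Triangulation n) {N : ℕ} (x : Fin N → E n)
  (Ω : Set (E n)) (a : Fin n → Fin n → E n → ℝ) (c₀ : E n → ℝ) (α : ℝ)

/-- The stiffness matrix `K_h = (a(φ_i, φ_j))`. -/
def stiffnessMatrix : Matrix (Fin N) (Fin N) ℝ :=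
  Matrix.of fun i j => bilinForm Ω a c₀ (𝒯.hat (x i)) (𝒯.hat (x j))

/-- `G_h = M_h + α K_h M_h⁻¹ K_h`. -/
def matrixG : Matrix (Fin N) (Fin N) ℝ :=
  𝒯.massMatrix x +
    α • (𝒯.stiffnessMatrix x Ω a c₀ * (𝒯.massMatrix x)⁻¹ * 𝒯.stiffnessMatrix x Ω a c₀)

/-- `M_h G_h⁻¹ M_h`. -/
def matrixMGM : Matrix (Fin N) (Fin N) ℝ :=
  𝒯.massMatrix x * (𝒯.matrixG x Ω a c₀ α)⁻¹ * 𝒯.massMatrix x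

/-- The constant `γ`, equal to `4` for `n = 2` and to `5` for `n = 3`. -/
def gamma (n : ℕ) : ℝ := if n = 2 then 4 else 5

/-- The `3 × 3` block diagonal matrix
`S_h = α⁻¹ diag (M_h G_h⁻¹ M_h + W_h - M_h, 0, γ M_h W_h⁻¹ M_h)`. -/
def matrixS : Matrix ((Fin N ⊕ Fin N) ⊕ Fin N) ((Fin N ⊕ Fin N) ⊕ Fin N) ℝ :=
  (1 / α) • Matrix.fromBlocks
    (Matrix.fromBlocks
      (𝒯.matrixMGM x Ω a c₀ α + 𝒯.lumpedMassMatrix x - 𝒯.massMatrix x) 0 0 0)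
    0 0
    (gamma n • (𝒯.massMatrix x * (𝒯.lumpedMassMatrix x)⁻¹ * 𝒯.massMatrix x))

end Triangulation

/-- `Λ = λ_max(A)`: `Λ` is the largest real eigenvalue of the matrix `A`. -/
def IsLargestEigenvalue {ι : Type*} [Fintype ι] (A : Matrix ι ι ℝ) (Λ : ℝ) : Prop :=
  IsGreatest {μ : ℝ | ∃ v : ι → ℝ, v ≠ 0 ∧ A.mulVec v = μ • v} Λ

/-- The Rayleigh quotient `zᵀ A z / zᵀ z`. -/
def rayleigh {ι : Type*} [Fintype ι] (A : Matrix ι ι ℝ) (z : ι → ℝ) : ℝ :=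
  (z ⬝ᵥ A.mulVec z) / (z ⬝ᵥ z)

end FEM

end

/-! Everything follows from three comparisons of quadratic forms, with constants independent of the
mesh: `m hⁿ ≤ M ≤ W ≤ ω hⁿ`, and row sums of `|K|` at most `R hⁿ⁻²`, where `ω` is the volume of the
unit ball. Then `M ≤ G` gives the lower bound for `G`. Since `K M⁻¹ K ≤ (m hⁿ)⁻¹ K²` and, by Schur's
test, `K² ≤ R² h²ⁿ⁻⁴`, the form of `G` is at most a constant times `hⁿ⁻⁴`, that is `h⁻²` for `n = 2`
and `h⁻¹` for `n = 3`. The principle that `0 ≤ A ≤ B` implies `A B⁻¹ A ≤ A`, applied to `M ≤ G` and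
`M ≤ W`, bounds all blocks of `S` by multiples of `hⁿ`.

The geometric input is that every cell contains a ball of radius `c h` with `c = 1 / (4κτ)`
(`exists_closedBall_subset_simplex`). Contracting it towards a vertex where the nodal value is
largest yields the lower bound for `M` (`massMatrix_ge`). An affine function with values in `[0, 1]`
on that ball has partial derivatives at most `1 / (c h)`, which yields the bound for `K`
(`sum_abs_stiffnessMatrix_le`). -/

namespace FEM

/-! ### Quadratic forms and eigenvalues of real matrices -/

section LinearAlgebra

open Matrix

variable {ι : Type*} [Fintype ι]

theorem dotProduct_mulVec_comm_of_isSymm {A : Matrix ι ι ℝ} (hA : A.IsSymm) (y z : ι → ℝ) :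
    y ⬝ᵥ A *ᵥ z = z ⬝ᵥ A *ᵥ y := by
  rw [dotProduct_mulVec, ← mulVec_transpose, hA.eq, dotProduct_comm]

theorem isUnit_det_of_forall_pos [DecidableEq ι] {B : Matrix ι ι ℝ}
    (hB : ∀ z, z ≠ 0 → 0 < z ⬝ᵥ B *ᵥ z) : IsUnit B.det := by
  rw [isUnit_iff_ne_zero]
  intro h
  obtain ⟨v, hv, hBv⟩ := Matrix.exists_mulVec_eq_zero_iff.2 h
  have := hB v hv
  simp [hBv] at this

theorem mulVec_inv_mulVec [DecidableEq ι] {B : Matrix ι ι ℝ} (hB : IsUnit B.det) (w : ι → ℝ) :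
    B *ᵥ (B⁻¹ *ᵥ w) = w := by
  rw [mulVec_mulVec, mul_nonsing_inv _ hB, one_mulVec]

/-- `zᵀ A B⁻¹ A z = yᵀ B y` for `y = B⁻¹ A z`. -/
theorem quadForm_mul_inv_mul [DecidableEq ι] {A B : Matrix ι ι ℝ} (hA : A.IsSymm)
    (hB : IsUnit B.det) (z : ι → ℝ) :
    z ⬝ᵥ (A * B⁻¹ * A) *ᵥ z = (B⁻¹ *ᵥ (A *ᵥ z)) ⬝ᵥ B *ᵥ (B⁻¹ *ᵥ (A *ᵥ z)) := by
  rw [mulVec_inv_mulVec hB, ← mulVec_mulVec, ← mulVec_mulVec,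
    dotProduct_mulVec_comm_of_isSymm hA]

/-- If `0 ≤ A ≤ B` as quadratic forms, then `A B⁻¹ A ≤ A`. -/
theorem quadForm_mul_inv_mul_le [DecidableEq ι] {A B : Matrix ι ι ℝ} (hA : A.IsSymm)
    (hB : IsUnit B.det) (hA0 : ∀ z, 0 ≤ z ⬝ᵥ A *ᵥ z) (hAB : ∀ z, z ⬝ᵥ A *ᵥ z ≤ z ⬝ᵥ B *ᵥ z)
    (z : ι → ℝ) : z ⬝ᵥ (A * B⁻¹ * A) *ᵥ z ≤ z ⬝ᵥ A *ᵥ z := by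
  rw [quadForm_mul_inv_mul hA hB]
  set y := B⁻¹ *ᵥ (A *ᵥ z) with hy
  have hBy : B *ᵥ y = A *ᵥ z := mulVec_inv_mulVec hB _
  -- Expanding the form of `A` at `z - y` gives `2 yᵀAz ≤ zᵀAz + yᵀAy`, and `yᵀAy ≤ yᵀBy = yᵀAz`
  -- absorbs the last term.
  have h1 := hA0 (z - y)
  have h2 := hAB y
  have h3 : z ⬝ᵥ A *ᵥ y = y ⬝ᵥ A *ᵥ z := dotProduct_mulVec_comm_of_isSymm hA z y
  simp only [mulVec_sub, dotProduct_sub, sub_dotProduct] at h1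
  rw [hBy] at h2 ⊢
  linarith

/-- If `M ≥ m > 0`, then `K M⁻¹ K ≤ m⁻¹ K²`. -/
theorem quadForm_mul_inv_mul_le_div [DecidableEq ι] {K M : Matrix ι ι ℝ} (hK : K.IsSymm)
    {m : ℝ} (hm : 0 < m) (hM : ∀ z, m * (z ⬝ᵥ z) ≤ z ⬝ᵥ M *ᵥ z) (hMu : IsUnit M.det)
    (z : ι → ℝ) : z ⬝ᵥ (K * M⁻¹ * K) *ᵥ z ≤ (K *ᵥ z ⬝ᵥ K *ᵥ z) / m := by
  rw [quadForm_mul_inv_mul hK hMu]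
  set y := M⁻¹ *ᵥ (K *ᵥ z) with hy
  have hMy : M *ᵥ y = K *ᵥ z := mulVec_inv_mulVec hMu _
  have h1 := hM y
  rw [hMy] at h1 ⊢
  set w := K *ᵥ z
  -- With `m yᵀy ≤ yᵀw` this square yields `m yᵀw ≤ wᵀw`; no square root of `M` is needed.
  have h2 : 0 ≤ (w - m • y) ⬝ᵥ (w - m • y) := by
    simpa using dotProduct_star_self_nonneg (w - m • y)
  simp only [dotProduct_sub, sub_dotProduct, smul_dotProduct, dotProduct_smul, smul_eq_mul] at h2
  rw [dotProduct_comm w y] at h2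
  rw [le_div_iff₀ hm]
  nlinarith

/-- Schur's test for symmetric matrices. -/
theorem dotProduct_mulVec_self_le_of_sum_abs_le {K : Matrix ι ι ℝ} (hK : K.IsSymm) {R : ℝ}
    (hR0 : 0 ≤ R) (hR : ∀ i, ∑ j, |K i j| ≤ R) (z : ι → ℝ) :
    K *ᵥ z ⬝ᵥ K *ᵥ z ≤ R ^ 2 * (z ⬝ᵥ z) := by
  have h1 : ∀ i, (K *ᵥ z) i * (K *ᵥ z) i ≤ R * ∑ j, |K i j| * z j ^ 2 := by
    intro i
    -- Cauchy–Schwarz with the weight `|K i j|` split evenly between the two factors.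
    have h := Finset.sum_sq_le_sum_mul_sum_of_sq_le_mul Finset.univ (r := fun j => K i j * z j)
      (f := fun j => |K i j|) (g := fun j => |K i j| * z j ^ 2) (fun j _ => abs_nonneg _)
      (fun j _ => by positivity)
      (fun j _ => le_of_eq (by rw [mul_pow, ← sq_abs (K i j)]; ring))
    calc (K *ᵥ z) i * (K *ᵥ z) i = (∑ j, K i j * z j) ^ 2 := by
          rw [sq]; rfl
      _ ≤ _ := h
      _ ≤ _ := mul_le_mul_of_nonneg_right (hR i) (Finset.sum_nonneg fun j _ => by positivity)
  calc K *ᵥ z ⬝ᵥ K *ᵥ z ≤ ∑ i, R * ∑ j, |K i j| * z j ^ 2 := Finset.sum_le_sum fun i _ => h1 i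
    _ = R * ∑ j, (∑ i, |K j i|) * z j ^ 2 := by
        rw [← Finset.mul_sum, Finset.sum_comm]
        congr 1
        refine Finset.sum_congr rfl fun j _ => ?_
        rw [Finset.sum_mul]
        exact Finset.sum_congr rfl fun i _ => by rw [hK.apply]
    _ ≤ R * ∑ j, R * z j ^ 2 := by
        gcongr with j _
        exact hR j
    _ = R ^ 2 * (z ⬝ᵥ z) := by
        simp only [dotProduct, Finset.mul_sum]
        exact Finset.sum_congr rfl fun j _ => by ring

theorem dotProduct_self_pos {z : ι → ℝ} (hz : z ≠ 0) : 0 < z ⬝ᵥ z := by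
  simpa using dotProduct_star_self_pos_iff.2 hz

/-- There are finitely many eigenvalues, so one suffices for a maximum to exist. A nonnegative one
makes the maximum equal to its absolute value, and testing the form on an eigenvector bounds it.
Symmetry of `A` plays no role. -/
theorem exists_isLargestEigenvalue [DecidableEq ι] (A : Matrix ι ι ℝ) {B : ℝ}
    (hB : ∀ z, z ⬝ᵥ A *ᵥ z ≤ B * (z ⬝ᵥ z))
    (h0 : ∃ μ : ℝ, 0 ≤ μ ∧ ∃ v : ι → ℝ, v ≠ 0 ∧ A *ᵥ v = μ • v) :
    ∃ Λ, IsLargestEigenvalue A Λ ∧ |Λ| ≤ B := by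
  have hfin : {μ : ℝ | ∃ v : ι → ℝ, v ≠ 0 ∧ A.mulVec v = μ • v}.Finite := by
    refine (Module.End.finite_hasEigenvalue (Matrix.toLin' A)).subset ?_
    rintro μ ⟨v, hv, hAv⟩
    exact Module.End.hasEigenvalue_of_hasEigenvector
      (x := v) ⟨Module.End.mem_eigenspace_iff.2 (by simpa using hAv), hv⟩
  obtain ⟨μ, hμ0, hμ⟩ := h0
  obtain ⟨Λ, hΛ, hmax⟩ := hfin.exists_maximalFor id _ ⟨μ, hμ⟩
  have hgr : IsLargestEigenvalue A Λ := ⟨hΛ, fun ν hν => by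
    rcases le_total ν Λ with h | h
    · exact h
    · exact hmax hν h⟩
  refine ⟨Λ, hgr, ?_⟩
  rw [abs_of_nonneg (hμ0.trans (hgr.2 hμ))]
  obtain ⟨v, hv, hAv⟩ := hΛ
  have h := hB v
  rw [hAv, dotProduct_smul, smul_eq_mul] at h
  exact le_of_mul_le_mul_right h (dotProduct_self_pos hv)

theorem exists_nonneg_eigenvalue [DecidableEq ι] [Nonempty ι] {A : Matrix ι ι ℝ} (hA : A.IsSymm)
    (h0 : ∀ z, 0 ≤ z ⬝ᵥ A *ᵥ z) :
    ∃ μ : ℝ, 0 ≤ μ ∧ ∃ v : ι → ℝ, v ≠ 0 ∧ A *ᵥ v = μ • v := by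
  have hH : A.IsHermitian := by
    rw [Matrix.IsHermitian, conjTranspose_eq_transpose_of_trivial]; exact hA
  obtain ⟨i⟩ := ‹Nonempty ι›
  have hv : (⇑(hH.eigenvectorBasis i) : ι → ℝ) ≠ 0 := fun h =>
    hH.eigenvectorBasis.orthonormal.ne_zero i (by ext j; exact congrFun h j)
  have hAv := hH.mulVec_eigenvectorBasis i
  refine ⟨hH.eigenvalues i, ?_, _, hv, hAv⟩
  have h := h0 ⇑(hH.eigenvectorBasis i)
  rw [hAv, dotProduct_smul, smul_eq_mul] at h
  exact nonneg_of_mul_nonneg_left h (dotProduct_self_pos hv)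

theorem dotProduct_fromBlocks_zero_mulVec {κ : Type*} [Fintype κ] (P : Matrix ι ι ℝ)
    (Q : Matrix κ κ ℝ) (z : ι ⊕ κ → ℝ) :
    z ⬝ᵥ fromBlocks P 0 0 Q *ᵥ z
      = (z ∘ Sum.inl) ⬝ᵥ P *ᵥ (z ∘ Sum.inl) + (z ∘ Sum.inr) ⬝ᵥ Q *ᵥ (z ∘ Sum.inr) := by
  rw [fromBlocks_mulVec]
  simp [dotProduct, Fintype.sum_sum_type]

theorem dotProduct_fromBlocks_zero_mulVec_le {κ : Type*} [Fintype κ] {P : Matrix ι ι ℝ}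
    {Q : Matrix κ κ ℝ} {B : ℝ} (hP : ∀ z, z ⬝ᵥ P *ᵥ z ≤ B * (z ⬝ᵥ z))
    (hQ : ∀ z, z ⬝ᵥ Q *ᵥ z ≤ B * (z ⬝ᵥ z)) (z : ι ⊕ κ → ℝ) :
    z ⬝ᵥ fromBlocks P 0 0 Q *ᵥ z ≤ B * (z ⬝ᵥ z) := by
  rw [dotProduct_fromBlocks_zero_mulVec]
  refine (add_le_add (hP _) (hQ _)).trans_eq ?_
  rw [← mul_add]
  simp [dotProduct, Fintype.sum_sum_type]

end LinearAlgebra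

/-! ### Cells and hat functions of a triangulation -/

namespace Triangulation

variable {n : ℕ} (𝒯 : Triangulation n)

theorem finite_cells : 𝒯.cells.Finite := 𝒯.finite.subset fun _ h => h.1

theorem isClosed_simplex (T : Finset (E n)) : IsClosed (simplex T) :=
  (T.finite_toSet.isCompact_convexHull ℝ).isClosed

theorem isBounded_simplex (T : Finset (E n)) : Bornology.IsBounded (simplex T) :=
  (T.finite_toSet.isCompact_convexHull ℝ).isBounded

theorem mem_simplex {T : Finset (E n)} {v : E n} (hv : v ∈ T) : v ∈ simplex T :=
  subset_convexHull ℝ _ hv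

variable {𝒯}

theorem interior_simplex_subset_domain {T : Finset (E n)} (hT : T ∈ 𝒯.cells) :
    interior (simplex T) ⊆ 𝒯.domain :=
  interior_mono (subset_biUnion_of_mem (u := fun T : Finset (E n) => simplex T) hT)

theorem rho_le_meshSize {T : Finset (E n)} (hT : T ∈ 𝒯.cells) : rho T ≤ 𝒯.meshSize :=
  le_csSup (𝒯.finite_cells.image _).bddAbove (mem_image_of_mem _ hT)

/-! ### Hat functions -/

theorem exists_isBarycentric {T : Finset (E n)} (hT : T ∈ 𝒯.cells) {p : E n}
    (hp : p ∈ simplex T) :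
    (∀ v, 0 ≤ 𝒯.hat v p) ∧ (∀ v, v ∉ T → 𝒯.hat v p = 0) ∧ ∑ v ∈ T, 𝒯.hat v p = 1 := by
  classical
  obtain ⟨u, hu0, hu1, hup⟩ := Finset.mem_convexHull'.1 hp
  have hb : 𝒯.IsBarycentric p fun v => if v ∈ T then u v else 0 := by
    refine ⟨T, hT, fun v hv => by simpa [hv] using hu0 v hv, fun v hv => if_neg hv, ?_, ?_⟩
    · rw [← hu1]
      exact Finset.sum_congr rfl fun v hv => if_pos hv
    · rw [← hup]
      exact Finset.sum_congr rfl fun v hv => by simp [hv]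
  have h := fun v => 𝒯.hat_eq hb v
  refine ⟨fun v => ?_, fun v hv => by rw [h, if_neg hv], ?_⟩
  · rw [h]
    split_ifs with hv
    exacts [hu0 v hv, le_rfl]
  · rw [← hu1]
    exact Finset.sum_congr rfl fun v hv => by rw [h, if_pos hv]

theorem hat_eq_zero_of_notMem {p : E n} (hp : ∀ T ∈ 𝒯.cells, p ∉ simplex T) (v : E n) :
    𝒯.hat v p = 0 := by
  rw [hat, dif_neg]
  rintro ⟨w, T, hT, h0, -, h1, hs⟩
  exact hp T hT (Finset.mem_convexHull'.2 ⟨w, h0, h1, hs⟩)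

theorem hat_nonneg (v p : E n) : 0 ≤ 𝒯.hat v p := by
  by_cases h : ∃ T ∈ 𝒯.cells, p ∈ simplex T
  · obtain ⟨T, hT, hp⟩ := h
    exact (exists_isBarycentric hT hp).1 v
  · push Not at h
    exact (hat_eq_zero_of_notMem h v).ge

theorem exists_cell_of_hat_ne_zero {v p : E n} (h : 𝒯.hat v p ≠ 0) :
    ∃ T ∈ 𝒯.cells, p ∈ simplex T ∧ v ∈ T := by
  by_contra! hc
  by_cases hT : ∃ T ∈ 𝒯.cells, p ∈ simplex T
  · obtain ⟨T, hT, hp⟩ := hT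
    exact h ((exists_isBarycentric hT hp).2.1 v (hc T hT hp))
  · push Not at hT
    exact h (hat_eq_zero_of_notMem hT v)

theorem mem_closedBall_of_hat_ne_zero {v p : E n} (h : 𝒯.hat v p ≠ 0) :
    p ∈ Metric.closedBall v 𝒯.meshSize := by
  obtain ⟨T, hT, hp, hv⟩ := exists_cell_of_hat_ne_zero h
  exact (Metric.dist_le_diam_of_mem (isBounded_simplex T) hp (mem_simplex hv)).trans
    (rho_le_meshSize hT)

section Nodes

variable {N : ℕ} {x : Fin N → E n}

/-- On a cell the hat functions of its vertices sum to 1; the nodes may omit some of these vertices,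
hence only an inequality. -/
theorem sum_hat_le_one (hx : Function.Injective x) (p : E n) :
    ∑ i, 𝒯.hat (x i) p ≤ 1 := by
  classical
  by_cases h : ∃ T ∈ 𝒯.cells, p ∈ simplex T
  · obtain ⟨T, hT, hp⟩ := h
    obtain ⟨h0, hz, h1⟩ := exists_isBarycentric hT hp
    rw [← h1, ← Finset.sum_image (f := fun v => 𝒯.hat v p) (g := x) (s := Finset.univ)
      (fun i _ j _ hij => hx hij)]
    rw [← Finset.sum_subset (Finset.inter_subset_left (s₂ := T)) fun v hv hv' =>
      hz v fun hvT => hv' (Finset.mem_inter.2 ⟨hv, hvT⟩)]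
    exact Finset.sum_le_sum_of_subset_of_nonneg Finset.inter_subset_right fun v _ _ => h0 v
  · push Not at h
    simp [hat_eq_zero_of_notMem h]

theorem hat_le_one (v p : E n) : 𝒯.hat v p ≤ 1 := by
  simpa using sum_hat_le_one (𝒯 := 𝒯) (x := fun _ : Fin 1 => v)
    (Function.injective_of_subsingleton _) p

open scoped Classical in
theorem card_filter_mem_cell_le (hx : Function.Injective x) {T : Finset (E n)}
    (hT : T ∈ 𝒯.cells) : (Finset.univ.filter fun i => x i ∈ T).card ≤ n + 1 := by
  rw [← hT.2, ← Finset.card_image_of_injective _ hx]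
  refine Finset.card_le_card fun v hv => ?_
  simp only [Finset.mem_image, Finset.mem_filter] at hv
  obtain ⟨i, ⟨-, hi⟩, rfl⟩ := hv
  exact hi

open scoped Classical in
theorem card_filter_hat_ne_zero_le (hx : Function.Injective x) (p : E n) :
    (Finset.univ.filter fun i => 𝒯.hat (x i) p ≠ 0).card ≤ n + 1 := by
  by_cases h : ∃ T ∈ 𝒯.cells, p ∈ simplex T
  · obtain ⟨T, hT, hp⟩ := h
    refine le_trans (Finset.card_le_card ?_) (card_filter_mem_cell_le hx hT)
    refine Finset.monotone_filter_right _ fun i _ hi => ?_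
    by_contra hiT
    exact hi ((exists_isBarycentric hT hp).2.1 _ hiT)
  · push Not at h
    simp [hat_eq_zero_of_notMem h]

end Nodes

/-! ### Affine structure of the hat functions on a cell -/

/-- On a cell, the hat function of each vertex agrees with an affine function, and these are
positive exactly in the interior. -/
theorem exists_affineMap_hat {T : Finset (E n)} (hT : T ∈ 𝒯.cells) :
    (interior (simplex T)).Nonempty ∧ ∃ f : E n → (E n →ᵃ[ℝ] ℝ),
      (∀ v, ∀ p ∈ simplex T, 𝒯.hat v p = f v p) ∧
      ∀ p ∈ interior (simplex T), ∀ v ∈ T, 0 < f v p := by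
  classical
  have hind := 𝒯.complex.indep hT.1
  have htop : affineSpan ℝ (range ((↑) : T → E n)) = ⊤ := by
    rw [hind.affineSpan_eq_top_iff_card_eq_finrank_add_one]
    simp [hT.2]
  let b : AffineBasis T ℝ (E n) := ⟨(↑), hind, htop⟩
  have hbv : ∀ v : T, b v = v := fun _ => rfl
  have hrange : range b = (T : Set (E n)) := Subtype.range_coe
  have hint : interior (simplex T) = {p | ∀ v, 0 < b.coord v p} := by
    rw [← b.interior_convexHull, hrange]; rfl
  have hhull : simplex T = {p | ∀ v, 0 ≤ b.coord v p} := by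
    rw [← b.convexHull_eq_nonneg_coord, hrange]; rfl
  refine ⟨?_, fun v => if h : v ∈ T then b.coord ⟨v, h⟩ else 0, fun v p hp => ?_, ?_⟩
  · rw [simplex, interior_convexHull_nonempty_iff_affineSpan_eq_top, ← hrange]
    exact htop
  · have hb : 𝒯.IsBarycentric p fun v => if h : v ∈ T then b.coord ⟨v, h⟩ p else 0 := by
      rw [hhull] at hp
      refine ⟨T, hT, fun v hv => by simpa [hv] using hp ⟨v, hv⟩, fun v hv => dif_neg hv, ?_, ?_⟩
      · rw [← Finset.sum_coe_sort]
        simpa using b.sum_coord_apply_eq_one p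
      · rw [← Finset.sum_coe_sort]
        simpa [hbv] using b.linear_combination_coord_eq_self p
    rw [𝒯.hat_eq hb]
    by_cases hv : v ∈ T <;> simp [hv]
  · intro p hp v hv
    rw [hint] at hp
    simpa [hv] using hp ⟨v, hv⟩

/-- At an interior point of `S` all hat functions of vertices of `S` are positive, while those of
points outside `T` vanish on `T`; so `S ⊆ T`, and the cardinalities agree. -/
theorem cell_eq_of_mem_interior {S T : Finset (E n)} (hS : S ∈ 𝒯.cells) (hT : T ∈ 𝒯.cells)
    {p : E n} (hpS : p ∈ interior (simplex S)) (hpT : p ∈ simplex T) : S = T := by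
  obtain ⟨-, f, hf, hpos⟩ := exists_affineMap_hat hS
  refine Finset.eq_of_subset_of_card_le (fun v hv => ?_) (by rw [hS.2, hT.2])
  by_contra hvT
  have h := hpos p hpS v hv
  rw [← hf v p (interior_subset hpS), (exists_isBarycentric hT hpT).2.1 v hvT] at h
  exact lt_irrefl _ h

/-- Extension by zero can make a hat function jump at the boundary of the mesh, so measurability is
glued from the finitely many closed cells and the complement of their union. -/
theorem measurable_hat (v : E n) : Measurable (𝒯.hat v) := by
  classical
  intro s hs
  have hU : MeasurableSet (⋃ T ∈ 𝒯.cells, simplex T) :=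
    𝒯.finite_cells.measurableSet_biUnion fun T _ => (isClosed_simplex T).measurableSet
  have h1 : 𝒯.hat v ⁻¹' s = (⋃ T ∈ 𝒯.cells, simplex T ∩ 𝒯.hat v ⁻¹' s) ∪
      ((⋃ T ∈ 𝒯.cells, simplex T)ᶜ ∩ 𝒯.hat v ⁻¹' s) := by
    rw [← iUnion₂_inter, ← union_inter_distrib_right, union_compl_self, univ_inter]
  rw [h1]
  refine MeasurableSet.union (𝒯.finite_cells.measurableSet_biUnion fun T hT => ?_) ?_
  · obtain ⟨-, f, hf, -⟩ := exists_affineMap_hat hT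
    have : simplex T ∩ 𝒯.hat v ⁻¹' s = simplex T ∩ f v ⁻¹' s := by
      ext p
      simp only [mem_inter_iff, mem_preimage]
      exact and_congr_right fun hp => by rw [hf v p hp]
    rw [this]
    exact (isClosed_simplex T).measurableSet.inter
      ((f v).continuous_of_finiteDimensional.measurable hs)
  · have h0 : ∀ p ∈ (⋃ T ∈ 𝒯.cells, simplex T)ᶜ, 𝒯.hat v p = 0 := fun p hp =>
      hat_eq_zero_of_notMem (fun T hT hpT => hp (mem_biUnion hT hpT)) v
    by_cases hs0 : (0 : ℝ) ∈ s
    · convert hU.compl using 1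
      exact inter_eq_left.2 fun p hp => by rw [mem_preimage, h0 p hp]; exact hs0
    · convert MeasurableSet.empty using 1
      rw [← disjoint_iff_inter_eq_empty, disjoint_left]
      intro p hp hps
      rw [mem_preimage, h0 p hp] at hps
      exact hs0 hps

theorem ae_notMem_frontier : ∀ᵐ p : E n, ∀ T ∈ 𝒯.cells, p ∉ frontier (simplex T) := by
  rw [ae_ball_iff 𝒯.finite_cells.countable]
  intro T _
  exact measure_eq_zero_iff_ae_notMem.1 ((convex_convexHull ℝ _).addHaar_frontier volume)

/-- A step of length `δ` from the centre along a coordinate axis changes `f` by at most 1. -/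
theorem abs_linear_single_le {f : E n →ᵃ[ℝ] ℝ} {q : E n} {δ : ℝ} (hδ : 0 < δ)
    (hf : ∀ p ∈ Metric.closedBall q δ, f p ∈ Icc (0 : ℝ) 1) (k : Fin n) :
    |f.linear (EuclideanSpace.single k 1)| ≤ 1 / δ := by
  have h1 := hf (q + δ • EuclideanSpace.single k 1) (by simp [norm_smul, abs_of_pos hδ])
  have h0 := hf q (Metric.mem_closedBall_self hδ.le)
  have h2 : f (q + δ • EuclideanSpace.single k 1)
      = δ * f.linear (EuclideanSpace.single k 1) + f q := by
    have := f.map_vadd q (δ • EuclideanSpace.single k (1 : ℝ))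
    simpa [add_comm] using this
  rw [h2] at h1
  rw [le_div_iff₀ hδ, ← abs_of_pos hδ, ← abs_mul, abs_le]
  constructor <;> linarith [h1.1, h1.2, h0.1, h0.2]

/-- The inverse estimate for hat functions. -/
theorem ae_abs_pderiv_hat_le {δ : ℝ} (hδ : 0 < δ)
    (hball : ∀ T ∈ 𝒯.cells, ∃ q, Metric.closedBall q δ ⊆ simplex T) :
    ∀ᵐ p : E n, ∀ v k, |pderiv k (𝒯.hat v) p| ≤ 1 / δ := by
  filter_upwards [ae_notMem_frontier (𝒯 := 𝒯)] with p hp v k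
  by_cases h : ∃ T ∈ 𝒯.cells, p ∈ simplex T
  · obtain ⟨T, hT, hpT⟩ := h
    have hpi : p ∈ interior (simplex T) := by
      by_contra hc
      exact hp T hT ⟨subset_closure hpT, hc⟩
    obtain ⟨-, f, hf, -⟩ := exists_affineMap_hat hT
    obtain ⟨q, hq⟩ := hball T hT
    have heq : 𝒯.hat v =ᶠ[nhds p] fun y => (f v).linear.toContinuousLinearMap y + f v 0 := by
      filter_upwards [mem_interior_iff_mem_nhds.1 hpi] with y hy
      rw [hf v y hy]
      exact congrFun (f v).decomp y
    have hd : HasFDerivAt (𝒯.hat v) (f v).linear.toContinuousLinearMap p :=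
      ((f v).linear.toContinuousLinearMap.hasFDerivAt.add_const _).congr_of_eventuallyEq heq
    rw [pderiv, hd.fderiv]
    refine abs_linear_single_le (q := q) hδ (fun y hy => ?_) k
    rw [← hf v y (hq hy)]
    exact ⟨hat_nonneg v y, hat_le_one v y⟩
  · push Not at h
    have hopen : (⋂ T ∈ 𝒯.cells, (simplex T)ᶜ) ∈ nhds p :=
      (𝒯.finite_cells.isOpen_biInter fun T _ => (isClosed_simplex T).isOpen_compl).mem_nhds
        (by simpa using h)
    have heq : 𝒯.hat v =ᶠ[nhds p] fun _ => 0 := by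
      filter_upwards [hopen] with y hy
      exact hat_eq_zero_of_notMem (by simpa using hy) v
    rw [pderiv, heq.fderiv_eq]
    simp [hδ.le]

/-- A zero of a nonnegative function is a minimum, where `fderiv` vanishes, by default if the
function is not differentiable there. No exceptional null set arises. -/
theorem pderiv_hat_eq_zero {v p : E n} (h : 𝒯.hat v p = 0) (k : Fin n) :
    pderiv k (𝒯.hat v) p = 0 := by
  have hmin : IsLocalMin (𝒯.hat v) p := Filter.Eventually.of_forall fun y => by
    rw [h]; exact hat_nonneg v y
  rw [pderiv, hmin.fderiv_eq_zero]
  rfl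

/-! ### Balls in cells -/

theorem exists_closedBall_subset_simplex (hn : 0 < n) {κ τ : ℝ} (hκ : 0 < κ) (hτ : 0 < τ)
    (hreg : 𝒯.IsRegularQuasiUniform κ τ) (hh : 0 < 𝒯.meshSize) {T : Finset (E n)}
    (hT : T ∈ 𝒯.cells) :
    ∃ q, Metric.closedBall q (1 / (4 * κ * τ) * 𝒯.meshSize) ⊆ simplex T := by
  obtain ⟨h1, h2⟩ := hreg T hT
  set D := {d : ℝ | 0 ≤ d ∧ ∃ p : E n, Metric.closedBall p (d / 2) ⊆ simplex T} with hD
  have hbdd : ∀ d ∈ D, d ≤ 2 * rho T := by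
    rintro d ⟨hd, p, hp⟩
    have h3 : dist (p + (d / 2) • EuclideanSpace.single ⟨0, hn⟩ (1 : ℝ)) p = d / 2 := by
      simp [norm_smul, abs_of_nonneg hd]
    have h4 := Metric.dist_le_diam_of_mem (isBounded_simplex T)
      (hp (Metric.mem_closedBall.2 h3.le)) (hp (Metric.mem_closedBall_self (by positivity)))
    rw [h3] at h4
    rw [rho]
    linarith
  have hBA : BddAbove D := ⟨_, hbdd⟩
  obtain ⟨q, hq⟩ := (exists_affineMap_hat hT).1
  obtain ⟨ε, hε, hball⟩ := Metric.nhds_basis_closedBall.mem_iff.1 (mem_interior_iff_mem_nhds.1 hq)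
  -- A ball inside the cell makes `sigma T` and `rho T` positive, so the two quotients in the
  -- regularity assumption are not divisions by zero.
  have hεD : 2 * ε ∈ D := ⟨by positivity, q, by convert hball using 2; ring⟩
  have hσ : 0 < sigma T := lt_of_lt_of_le (by positivity) (le_csSup hBA hεD)
  have hρ : 0 < rho T := by
    have := hbdd _ hεD
    linarith
  rw [div_le_iff₀ hσ] at h1
  rw [div_le_iff₀ hρ] at h2
  -- Half the supremum avoids proving that it is attained. A diameter `d > sigma T / 2` gives a
  -- radius above `sigma T / 4`, whence the 4 in `1 / (4κτ)`.
  have h5 : sigma T / 2 < sSup D := by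
    change sigma T / 2 < sigma T
    linarith
  obtain ⟨d, ⟨-, p, hp⟩, hd⟩ := exists_lt_of_lt_csSup ⟨_, hεD⟩ h5
  refine ⟨p, (Metric.closedBall_subset_closedBall ?_).trans hp⟩
  have h6 : 𝒯.meshSize ≤ κ * τ * sigma T := by nlinarith
  rw [one_div_mul_eq_div, div_le_iff₀ (by positivity)]
  nlinarith [mul_pos hκ hτ]

/-- The homothety with centre `w` and ratio `1/4` maps the cell into itself, and on its image the
affine hat function of `w` is at least `3/4` of its value 1 at `w`. -/
theorem exists_ball_hat_ge {T : Finset (E n)} (hT : T ∈ 𝒯.cells) {q : E n} {δ : ℝ}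
    (hq : Metric.closedBall q δ ⊆ simplex T) {w : E n} (hw : w ∈ T) :
    ∃ q', Metric.ball q' (δ / 4) ⊆ simplex T ∧
      ∀ p ∈ Metric.ball q' (δ / 4), 3 / 4 ≤ 𝒯.hat w p := by
  classical
  obtain ⟨-, f, hf, -⟩ := exists_affineMap_hat hT
  have hwT := mem_simplex hw
  have key : ∀ p ∈ Metric.ball (AffineMap.lineMap w q (1 / 4 : ℝ)) (δ / 4),
      ∃ y ∈ simplex T, p = AffineMap.lineMap w y (1 / 4 : ℝ) := by
    intro p hp
    refine ⟨AffineMap.lineMap w p (4 : ℝ), hq ?_, ?_⟩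
    · rw [Metric.mem_closedBall, dist_eq_norm]
      rw [Metric.mem_ball, dist_eq_norm] at hp
      have : AffineMap.lineMap w p (4 : ℝ) - q
          = (4 : ℝ) • (p - AffineMap.lineMap w q (1 / 4 : ℝ)) := by
        simp only [AffineMap.lineMap_apply_module]
        module
      rw [this, norm_smul]
      norm_num
      linarith
    · simp only [AffineMap.lineMap_apply_module]
      module
  refine ⟨AffineMap.lineMap w q (1 / 4 : ℝ), fun p hp => ?_, fun p hp => ?_⟩
  · obtain ⟨y, hy, rfl⟩ := key p hp
    exact (convex_convexHull ℝ _).lineMap_mem hwT hy (by norm_num)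
  · obtain ⟨y, hy, rfl⟩ := key p hp
    have hmem : AffineMap.lineMap w y (1 / 4 : ℝ) ∈ simplex T :=
      (convex_convexHull ℝ _).lineMap_mem hwT hy (by norm_num)
    have hvert : w ∈ 𝒯.vertices :=
      𝒯.complex.down_closed hT.1 (Finset.singleton_subset_iff.2 hw) (Finset.singleton_nonempty w)
    rw [hf w _ hmem, AffineMap.apply_lineMap, ← hf w _ hwT, ← hf w _ hy, 𝒯.hat_vertex hvert,
      if_pos rfl, AffineMap.lineMap_apply_module]
    have := hat_nonneg (𝒯 := 𝒯) w y
    simp only [smul_eq_mul]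
    linarith

end Triangulation

/-! ### Volumes of balls and essential bounds -/

theorem volume_real_ball {n : ℕ} (q : E n) {r : ℝ} (hr : 0 < r) :
    volume.real (Metric.ball q r) = r ^ n * volume.real (Metric.ball (0 : E n) 1) := by
  rw [measureReal_def, Measure.addHaar_ball_of_pos volume q hr, ENNReal.toReal_mul,
    ENNReal.toReal_ofReal (by positivity), finrank_euclideanSpace_fin, measureReal_def]

theorem volume_real_closedBall {n : ℕ} (q : E n) {r : ℝ} (hr : 0 < r) :
    volume.real (Metric.closedBall q r) = r ^ n * volume.real (Metric.ball (0 : E n) 1) := by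
  rw [measureReal_def, Measure.addHaar_closedBall volume q hr.le, ENNReal.toReal_mul,
    ENNReal.toReal_ofReal (by positivity), finrank_euclideanSpace_fin, measureReal_def]

theorem volume_real_unitBall_pos (n : ℕ) : 0 < volume.real (Metric.ball (0 : E n) 1) :=
  ENNReal.toReal_pos (Metric.measure_ball_pos _ _ one_pos).ne' measure_ball_lt_top.ne

theorem exists_ae_abs_le {β : Type*} [MeasurableSpace β] {μ : Measure β} {f : β → ℝ}
    (hf : MemLp f ⊤ μ) : ∃ C, ∀ᵐ p ∂μ, |f p| ≤ C := by
  refine ⟨(eLpNormEssSup f μ).toReal, ?_⟩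
  have hlt : eLpNormEssSup f μ ≠ ⊤ := by
    rw [← eLpNorm_exponent_top]; exact hf.2.ne
  filter_upwards [ae_le_eLpNormEssSup (f := f) (μ := μ)] with p hp
  have := ENNReal.toReal_mono hlt hp
  simpa using this

/-! ### Mass and lumped mass matrices -/

namespace Triangulation

open Matrix

variable {n : ℕ} {𝒯 : Triangulation n}

theorem abs_hat_le_indicator (v p : E n) :
    |𝒯.hat v p| ≤ (Metric.closedBall v 𝒯.meshSize).indicator (fun _ => (1 : ℝ)) p := by
  by_cases h : 𝒯.hat v p = 0
  · rw [h, abs_zero]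
    exact indicator_nonneg (fun _ _ => zero_le_one) _
  · rw [indicator_of_mem (mem_closedBall_of_hat_ne_zero h), abs_of_nonneg (hat_nonneg v p)]
    exact hat_le_one v p

theorem integrable_indicator_closedBall (v : E n) (r c : ℝ) :
    Integrable ((Metric.closedBall v r).indicator fun _ => c) :=
  (integrable_indicator_iff Metric.isClosed_closedBall.measurableSet).2
    (integrableOn_const measure_closedBall_lt_top.ne)

theorem integrable_hat (v : E n) : Integrable (𝒯.hat v) :=
  (integrable_indicator_closedBall v 𝒯.meshSize 1).mono'
    (measurable_hat v).aestronglyMeasurable (Filter.Eventually.of_forall fun p =>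
      abs_hat_le_indicator v p)

theorem integrable_hat_mul_hat (v w : E n) :
    Integrable fun p => 𝒯.hat v p * 𝒯.hat w p := by
  refine (integrable_hat (𝒯 := 𝒯) v).mono'
    ((measurable_hat v).mul (measurable_hat w)).aestronglyMeasurable
    (Filter.Eventually.of_forall fun p => ?_)
  rw [Real.norm_of_nonneg (mul_nonneg (hat_nonneg v p) (hat_nonneg w p))]
  exact mul_le_of_le_one_right (hat_nonneg v p) (hat_le_one w p)

theorem integral_domain_hat_le (hh : 0 < 𝒯.meshSize) (v : E n) :
    ∫ p in 𝒯.domain, 𝒯.hat v p ≤ volume.real (Metric.ball (0 : E n) 1) * 𝒯.meshSize ^ n := by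
  calc ∫ p in 𝒯.domain, 𝒯.hat v p ≤ ∫ p, 𝒯.hat v p :=
        setIntegral_le_integral (integrable_hat v) (Filter.Eventually.of_forall (hat_nonneg v))
    _ ≤ ∫ p, (Metric.closedBall v 𝒯.meshSize).indicator (fun _ => (1 : ℝ)) p :=
        integral_mono (integrable_hat v) (integrable_indicator_closedBall _ _ _) fun p =>
          (le_abs_self _).trans (abs_hat_le_indicator v p)
    _ = volume.real (Metric.closedBall v 𝒯.meshSize) :=
        integral_indicator_one Metric.isClosed_closedBall.measurableSet
    _ = _ := by rw [volume_real_closedBall v hh, mul_comm]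

variable {N : ℕ} {x : Fin N → E n}

theorem massMatrix_isSymm : (𝒯.massMatrix x).IsSymm := by
  ext i j
  simp only [massMatrix, transpose_apply, of_apply]
  simp_rw [mul_comm]

theorem sq_sum_mul_hat (z : Fin N → ℝ) (p : E n) :
    (∑ i, z i * 𝒯.hat (x i) p) ^ 2
      = ∑ i, ∑ j, z i * z j * (𝒯.hat (x i) p * 𝒯.hat (x j) p) := by
  rw [sq, Finset.sum_mul_sum]
  exact Finset.sum_congr rfl fun i _ => Finset.sum_congr rfl fun j _ => by ring

theorem integrable_sq_sum_mul_hat (z : Fin N → ℝ) :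
    Integrable fun p => (∑ i, z i * 𝒯.hat (x i) p) ^ 2 := by
  simp_rw [sq_sum_mul_hat]
  exact integrable_finsetSum _ fun i _ => integrable_finsetSum _ fun j _ =>
    (integrable_hat_mul_hat _ _).const_mul _

theorem dotProduct_massMatrix_mulVec (z : Fin N → ℝ) :
    z ⬝ᵥ 𝒯.massMatrix x *ᵥ z = ∫ p in 𝒯.domain, (∑ i, z i * 𝒯.hat (x i) p) ^ 2 := by
  simp_rw [sq_sum_mul_hat]
  rw [integral_finsetSum _ fun i _ => integrable_finsetSum _ fun j _ =>
    ((integrable_hat_mul_hat _ _).const_mul _).integrableOn]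
  refine Finset.sum_congr rfl fun i _ => ?_
  rw [integral_finsetSum _ fun j _ => ((integrable_hat_mul_hat _ _).const_mul _).integrableOn,
    mulVec, dotProduct, Finset.mul_sum]
  refine Finset.sum_congr rfl fun j _ => ?_
  rw [integral_const_mul, massMatrix, of_apply]
  ring

theorem dotProduct_lumpedMassMatrix_mulVec (z : Fin N → ℝ) :
    z ⬝ᵥ 𝒯.lumpedMassMatrix x *ᵥ z = ∑ i, (∫ p in 𝒯.domain, 𝒯.hat (x i) p) * z i ^ 2 := by
  refine Finset.sum_congr rfl fun i _ => ?_
  rw [lumpedMassMatrix, mulVec_diagonal]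
  ring

theorem massMatrix_nonneg (z : Fin N → ℝ) : 0 ≤ z ⬝ᵥ 𝒯.massMatrix x *ᵥ z := by
  rw [dotProduct_massMatrix_mulVec]
  exact integral_nonneg fun p => sq_nonneg _

theorem massMatrix_le_lumpedMassMatrix (hx : Function.Injective x) (z : Fin N → ℝ) :
    z ⬝ᵥ 𝒯.massMatrix x *ᵥ z ≤ z ⬝ᵥ 𝒯.lumpedMassMatrix x *ᵥ z := by
  rw [dotProduct_massMatrix_mulVec, dotProduct_lumpedMassMatrix_mulVec]
  simp_rw [← integral_mul_const]
  rw [← integral_finsetSum _ fun i _ => ((integrable_hat _).mul_const _).integrableOn]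
  refine integral_mono (integrable_sq_sum_mul_hat z).integrableOn
    (integrable_finsetSum _ fun i _ => ((integrable_hat _).mul_const _).integrableOn)
    fun p => ?_
  -- Pointwise Cauchy–Schwarz with the hat functions as weights, whose sum is at most 1.
  have h := Finset.sum_sq_le_sum_mul_sum_of_sq_le_mul Finset.univ
    (r := fun i => z i * 𝒯.hat (x i) p) (f := fun i => 𝒯.hat (x i) p)
    (g := fun i => 𝒯.hat (x i) p * z i ^ 2) (fun i _ => hat_nonneg _ _)
    (fun i _ => mul_nonneg (hat_nonneg _ _) (sq_nonneg _)) (fun i _ => le_of_eq (by ring))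
  exact h.trans (mul_le_of_le_one_left
    (Finset.sum_nonneg fun i _ => mul_nonneg (hat_nonneg _ _) (sq_nonneg _))
    (sum_hat_le_one hx p))

theorem lumpedMassMatrix_le (hh : 0 < 𝒯.meshSize) (z : Fin N → ℝ) :
    z ⬝ᵥ 𝒯.lumpedMassMatrix x *ᵥ z
      ≤ volume.real (Metric.ball (0 : E n) 1) * 𝒯.meshSize ^ n * (z ⬝ᵥ z) := by
  rw [dotProduct_lumpedMassMatrix_mulVec, dotProduct, Finset.mul_sum]
  refine Finset.sum_le_sum fun i _ => ?_
  rw [← sq]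
  exact mul_le_mul_of_nonneg_right (integral_domain_hat_le hh _) (sq_nonneg _)

/-- A cell that contains a ball of radius `δ` contains a ball of radius `δ / 4` on which a
piecewise linear function is at least half as large as at each vertex of the cell. -/
theorem exists_ball_sq_le (hx : Function.Injective x) {T : Finset (E n)} (hT : T ∈ 𝒯.cells)
    {δ : ℝ} (hδ : 0 < δ) (hball : ∃ q, Metric.closedBall q δ ⊆ simplex T) (z : Fin N → ℝ) :
    ∃ q', Metric.ball q' (δ / 4) ⊆ simplex T ∧ ∀ p ∈ Metric.ball q' (δ / 4), ∀ i, x i ∈ T →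
      z i ^ 2 / 4 ≤ (∑ j, z j * 𝒯.hat (x j) p) ^ 2 := by
  classical
  obtain ⟨q, hq⟩ := hball
  rcases (Finset.univ.filter fun i => x i ∈ T).eq_empty_or_nonempty with he | hne
  · refine ⟨q, fun p hp => hq (Metric.mem_closedBall.2 ?_), fun p _ i hi => ?_⟩
    · linarith [Metric.mem_ball.1 hp]
    · exact absurd hi (by simpa using Finset.ext_iff.1 he i)
  · obtain ⟨i, hi, hmax⟩ := Finset.exists_max_image _ (fun i => |z i|) hne
    simp only [Finset.mem_filter, Finset.mem_univ, true_and] at hi hmax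
    obtain ⟨q', hq', hge⟩ := exists_ball_hat_ge hT hq hi
    refine ⟨q', hq', fun p hp j hj => ?_⟩
    have h34 := hge p hp
    obtain ⟨-, hzero, -⟩ := exists_isBarycentric hT (hq' hp)
    have hsum := sum_hat_le_one (𝒯 := 𝒯) hx p
    rw [← Finset.add_sum_erase _ _ (Finset.mem_univ i)] at hsum
    have hrest : |∑ k ∈ Finset.univ.erase i, z k * 𝒯.hat (x k) p|
        ≤ |z i| * ∑ k ∈ Finset.univ.erase i, 𝒯.hat (x k) p := by
      rw [Finset.mul_sum]
      refine (Finset.abs_sum_le_sum_abs _ _).trans (Finset.sum_le_sum fun k _ => ?_)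
      rw [abs_mul, abs_of_nonneg (hat_nonneg (x k) p)]
      by_cases hk : x k ∈ T
      · exact mul_le_mul_of_nonneg_right (hmax k hk) (hat_nonneg _ _)
      · simp [hzero _ hk]
    have hmain : |z i| / 2 ≤ |∑ k, z k * 𝒯.hat (x k) p| := by
      rw [← Finset.add_sum_erase _ _ (Finset.mem_univ i)]
      have h1 := abs_sub_abs_le_abs_add (z i * 𝒯.hat (x i) p)
        (∑ k ∈ Finset.univ.erase i, z k * 𝒯.hat (x k) p)
      rw [abs_mul, abs_of_nonneg (hat_nonneg (x i) p)] at h1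
      -- The largest nodal value has weight at least `3/4`, so the others can cancel at most a
      -- quarter of `|z i|`, leaving one half.
      have h2 : |z i| * ∑ k ∈ Finset.univ.erase i, 𝒯.hat (x k) p ≤ |z i| * (1 / 4) :=
        mul_le_mul_of_nonneg_left (by linarith) (abs_nonneg _)
      have h3 : |z i| * (3 / 4) ≤ |z i| * 𝒯.hat (x i) p :=
        mul_le_mul_of_nonneg_left h34 (abs_nonneg _)
      linarith
    calc z j ^ 2 / 4 = (|z j| / 2) ^ 2 := by rw [div_pow, sq_abs]; norm_num
      _ ≤ |∑ k, z k * 𝒯.hat (x k) p| ^ 2 := by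
          gcongr
          linarith [hmax j hj]
      _ = _ := sq_abs _

/-- The form of `M` is the integral of a squared piecewise linear function, which is bounded below
on one small ball per cell. These balls are disjoint, every node lies in some cell, and a cell has
at most `n + 1` nodes, which produces the factor `n + 1`. -/
theorem massMatrix_ge (hx : Function.Injective x) (hxv : range x ⊆ 𝒯.vertices)
    {δ : ℝ} (hδ : 0 < δ) (hball : ∀ T ∈ 𝒯.cells, ∃ q, Metric.closedBall q δ ⊆ simplex T)
    (z : Fin N → ℝ) :
    volume.real (Metric.ball (0 : E n) 1) * (δ / 4) ^ n / (4 * (n + 1)) * (z ⬝ᵥ z)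
      ≤ z ⬝ᵥ 𝒯.massMatrix x *ᵥ z := by
  classical
  rw [dotProduct_massMatrix_mulVec]
  set V : E n → ℝ := fun p => (∑ i, z i * 𝒯.hat (x i) p) ^ 2 with hV
  have hVint : Integrable V := integrable_sq_sum_mul_hat z
  choose! q hqT hqz using fun (T : Finset (E n)) (hT : T ∈ 𝒯.cells) =>
    exists_ball_sq_le hx hT hδ (hball T hT) z
  set s := 𝒯.finite_cells.toFinset with hs
  have hsm : ∀ {T}, T ∈ s ↔ T ∈ 𝒯.cells := 𝒯.finite_cells.mem_toFinset
  have hint : ∀ T ∈ s, Metric.ball (q T) (δ / 4) ⊆ interior (simplex T) := fun T hT =>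
    interior_maximal (hqT T (hsm.1 hT)) Metric.isOpen_ball
  have h1 : ∑ T ∈ s, ∫ p in Metric.ball (q T) (δ / 4), V p ≤ ∫ p in 𝒯.domain, V p := by
    rw [← integral_biUnion_finset _ (fun T _ => Metric.isOpen_ball.measurableSet) ?_
      fun T _ => hVint.integrableOn]
    · refine setIntegral_mono_set hVint.integrableOn
        (Filter.Eventually.of_forall fun p => sq_nonneg _) (Filter.Eventually.of_forall ?_)
      exact iUnion₂_subset fun T hT =>
        (hint T hT).trans (interior_simplex_subset_domain (hsm.1 hT))
    · intro S hS T hT hST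
      refine disjoint_left.2 fun p hpS hpT => hST ?_
      exact cell_eq_of_mem_interior (hsm.1 hS) (hsm.1 hT) (hint S hS hpS)
        (interior_subset (hint T hT hpT))
  set ω := volume.real (Metric.ball (0 : E n) 1) with hω
  have h2 : ∀ T ∈ s, ∀ i, x i ∈ T →
      (δ / 4) ^ n * ω * (z i ^ 2 / 4) ≤ ∫ p in Metric.ball (q T) (δ / 4), V p := by
    intro T hT i hi
    rw [← volume_real_ball (q T) (by positivity : 0 < δ / 4), ← smul_eq_mul, ← setIntegral_const]
    exact setIntegral_mono_on (integrableOn_const measure_ball_lt_top.ne) hVint.integrableOn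
      Metric.isOpen_ball.measurableSet fun p hp => hqz T (hsm.1 hT) p hp i hi
  have h3 : ∀ T ∈ s, ∑ i, (if x i ∈ T then (δ / 4) ^ n * ω * (z i ^ 2 / 4) else 0)
      ≤ (n + 1) * ∫ p in Metric.ball (q T) (δ / 4), V p := by
    intro T hT
    rw [← Finset.sum_filter]
    refine (Finset.sum_le_card_nsmul _ _ (∫ p in Metric.ball (q T) (δ / 4), V p)
      fun i hi => h2 T hT i (Finset.mem_filter.1 hi).2).trans ?_
    rw [nsmul_eq_mul]
    refine mul_le_mul_of_nonneg_right ?_ (integral_nonneg fun p => sq_nonneg _)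
    exact_mod_cast card_filter_mem_cell_le hx (hsm.1 hT)
  have h4 : ∑ i, (δ / 4) ^ n * ω * (z i ^ 2 / 4)
      ≤ ∑ T ∈ s, ∑ i, (if x i ∈ T then (δ / 4) ^ n * ω * (z i ^ 2 / 4) else 0) := by
    rw [Finset.sum_comm]
    refine Finset.sum_le_sum fun i _ => ?_
    obtain ⟨T, hT, hsub, hcard⟩ := 𝒯.pure _ (hxv (mem_range_self i))
    have hiT : x i ∈ T := hsub (Finset.mem_singleton_self _)
    have h0 : 0 ≤ (δ / 4) ^ n * ω * (z i ^ 2 / 4) := by positivity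
    refine le_trans ?_ (Finset.single_le_sum (fun S _ => ?_) (hsm.2 ⟨hT, hcard⟩))
    · rw [if_pos hiT]
    · split_ifs <;> [exact h0; exact le_rfl]
  have h5 : ∑ i, (δ / 4) ^ n * ω * (z i ^ 2 / 4) ≤ (n + 1) * ∫ p in 𝒯.domain, V p := by
    refine (h4.trans (Finset.sum_le_sum h3)).trans ?_
    rw [← Finset.mul_sum]
    gcongr
  have h6 : ∑ i, (δ / 4) ^ n * ω * (z i ^ 2 / 4) = (δ / 4) ^ n * ω / 4 * (z ⬝ᵥ z) := by
    rw [dotProduct, Finset.mul_sum]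
    exact Finset.sum_congr rfl fun i _ => by ring
  rw [h6] at h5
  have h7 : ω * (δ / 4) ^ n / (4 * (n + 1)) * (z ⬝ᵥ z)
      = ((δ / 4) ^ n * ω / 4 * (z ⬝ᵥ z)) / (n + 1) := by
    field_simp
  rw [h7, div_le_iff₀ (by positivity), mul_comm]
  linarith

/-! ### The stiffness matrix -/

variable {Ω : Set (E n)} {a : Fin n → Fin n → E n → ℝ} {c₀ : E n → ℝ} {θ : ℝ}

theorem stiffnessMatrix_isSymm (hL : IsElliptic Ω a c₀ θ) :
    (𝒯.stiffnessMatrix x Ω a c₀).IsSymm := by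
  ext i j
  simp only [stiffnessMatrix, transpose_apply, of_apply, bilinForm]
  refine integral_congr_ae ?_
  filter_upwards [hL.symm] with p hp
  congr 1
  · rw [Finset.sum_comm]
    refine Finset.sum_congr rfl fun k _ => Finset.sum_congr rfl fun l _ => ?_
    rw [hp k l]
    ring
  · ring

theorem abs_bilinForm_integrand_le {A δ : ℝ} {v w p : E n}
    (ha : ∀ k l, |a k l p| ≤ A) (hc : |c₀ p| ≤ A)
    (hd : ∀ v k, |pderiv k (𝒯.hat v) p| ≤ 1 / δ) :
    |(∑ k, ∑ l, a l k p * pderiv k (𝒯.hat v) p * pderiv l (𝒯.hat w) p)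
        + c₀ p * 𝒯.hat v p * 𝒯.hat w p|
      ≤ ({p | 𝒯.hat v p ≠ 0} ∩ {p | 𝒯.hat w p ≠ 0}).indicator
        (fun _ => n ^ 2 * A / δ ^ 2 + A) p := by
  have hA : 0 ≤ A := (abs_nonneg _).trans hc
  by_cases hv : 𝒯.hat v p = 0
  · simp [pderiv_hat_eq_zero hv, hv]
  by_cases hw : 𝒯.hat w p = 0
  · simp [pderiv_hat_eq_zero hw, hw]
  rw [indicator_of_mem (show p ∈ {p | 𝒯.hat v p ≠ 0} ∩ {p | 𝒯.hat w p ≠ 0} from ⟨hv, hw⟩)]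
  refine (abs_add_le _ _).trans (add_le_add ?_ ?_)
  · calc _ ≤ ∑ k : Fin n, ∑ l : Fin n, A * (1 / δ) * (1 / δ) := by
          refine (Finset.abs_sum_le_sum_abs _ _).trans (Finset.sum_le_sum fun k _ => ?_)
          refine (Finset.abs_sum_le_sum_abs _ _).trans (Finset.sum_le_sum fun l _ => ?_)
          rw [abs_mul, abs_mul]
          have h0 := (abs_nonneg _).trans (hd v k)
          exact mul_le_mul (mul_le_mul (ha l k) (hd v k) (abs_nonneg _) hA) (hd w l)
            (abs_nonneg _) (mul_nonneg hA h0)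
      _ = _ := by
          simp only [Finset.sum_const, Finset.card_univ, Fintype.card_fin, nsmul_eq_mul]
          ring
  · rw [abs_mul, abs_mul, abs_of_nonneg (hat_nonneg v p), abs_of_nonneg (hat_nonneg w p)]
    exact (mul_le_of_le_one_right (mul_nonneg (abs_nonneg _) (hat_nonneg v p))
      (hat_le_one w p)).trans ((mul_le_of_le_one_right (abs_nonneg _) (hat_le_one v p)).trans hc)

/-- Summing over `j` under the integral sign replaces a count of the neighbours of a node by the
pointwise fact that at most `n + 1` hat functions are nonzero. The support of the `i`-th one lies in
a ball of radius `h`. -/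
theorem sum_abs_stiffnessMatrix_le (hx : Function.Injective x) (hh : 0 < 𝒯.meshSize)
    {A δ : ℝ} (hA : 0 ≤ A) (hδ : 0 < δ)
    (hball : ∀ T ∈ 𝒯.cells, ∃ q, Metric.closedBall q δ ⊆ simplex T)
    (ha : ∀ᵐ p ∂(volume.restrict Ω), ∀ k l, |a k l p| ≤ A)
    (hc : ∀ᵐ p ∂(volume.restrict Ω), |c₀ p| ≤ A) (i : Fin N) :
    ∑ j, |𝒯.stiffnessMatrix x Ω a c₀ i j| ≤
      (n + 1) * (n ^ 2 * A / δ ^ 2 + A) *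
        (volume.real (Metric.ball (0 : E n) 1) * 𝒯.meshSize ^ n) := by
  classical
  set D := n ^ 2 * A / δ ^ 2 + A with hD
  have hD0 : 0 ≤ D := by positivity
  set S : Fin N → Set (E n) := fun j => {p | 𝒯.hat (x j) p ≠ 0} with hS
  have hSm : ∀ j, MeasurableSet (S j) := fun j =>
    (measurable_hat (x j) (measurableSet_singleton 0)).compl
  set g : Fin N → E n → ℝ := fun j => (S i ∩ S j).indicator fun _ => D with hg
  set B := Metric.closedBall (x i) 𝒯.meshSize with hB
  have hSB : S i ⊆ B := fun p hp => mem_closedBall_of_hat_ne_zero hp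
  have hgi : ∀ j, Integrable (g j) := fun j =>
    (integrable_indicator_iff ((hSm i).inter (hSm j))).2 (integrableOn_const
      ((measure_mono (inter_subset_left.trans hSB)).trans_lt measure_closedBall_lt_top).ne)
  have h1 : ∀ j, |𝒯.stiffnessMatrix x Ω a c₀ i j| ≤ ∫ p in Ω, g j p := by
    intro j
    rw [stiffnessMatrix, of_apply, bilinForm, ← Real.norm_eq_abs]
    refine norm_integral_le_of_norm_le (hgi j).integrableOn ?_
    filter_upwards [ha, hc, ae_restrict_of_ae (ae_abs_pderiv_hat_le hδ hball)] with p h1 h2 h3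
    exact abs_bilinForm_integrand_le h1 h2 h3
  calc _ ≤ ∑ j, ∫ p in Ω, g j p := Finset.sum_le_sum fun j _ => h1 j
    _ = ∫ p in Ω, ∑ j, g j p := (integral_finsetSum _ fun j _ => (hgi j).integrableOn).symm
    _ ≤ ∫ p, ∑ j, g j p := setIntegral_le_integral (integrable_finsetSum _ fun j _ => hgi j)
        (Filter.Eventually.of_forall fun p => Finset.sum_nonneg fun j _ =>
          indicator_nonneg (fun _ _ => hD0) _)
    _ ≤ ∫ p, B.indicator (fun _ => (n + 1) * D) p := by
        refine integral_mono (integrable_finsetSum _ fun j _ => hgi j)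
          (integrable_indicator_closedBall _ _ _) fun p => ?_
        by_cases hp : p ∈ S i
        · rw [indicator_of_mem (hSB hp)]
          have : ∀ j, g j p = if 𝒯.hat (x j) p ≠ 0 then D else 0 := fun j => by
            simp only [hg, indicator_apply, mem_inter_iff, hp, true_and]
            rfl
          simp only [this]
          rw [← Finset.sum_filter, Finset.sum_const, nsmul_eq_mul]
          refine mul_le_mul_of_nonneg_right ?_ hD0
          exact_mod_cast card_filter_hat_ne_zero_le hx p
        · have : ∀ j, g j p = 0 := fun j => indicator_of_notMem (fun h => hp h.1) _
          simp only [this, Finset.sum_const_zero]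
          exact indicator_nonneg (fun _ _ => by positivity) _
    _ = _ := by
        rw [integral_indicator Metric.isClosed_closedBall.measurableSet, setIntegral_const,
          volume_real_closedBall _ hh, smul_eq_mul]
        ring

end Triangulation

/-! ### Combining the estimates -/

namespace Triangulation

open Matrix

/-- The bounds for `G_h`, `M_h G_h⁻¹ M_h` and `S_h` in any positive dimension. -/
theorem exists_matrix_bounds {n : ℕ} (hn : 0 < n) {Ω : Set (E n)}
    {a : Fin n → Fin n → E n → ℝ} {c₀ : E n → ℝ} {θ : ℝ} (hL : IsElliptic Ω a c₀ θ)
    {α : ℝ} (hα : 0 < α) {κ τ : ℝ} (hκ : 0 < κ) (hτ : 0 < τ) :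
    ∃ l u C : ℝ, 0 < l ∧ 0 < u ∧ 0 < C ∧
      ∀ (𝒯 : Triangulation n), 0 < 𝒯.meshSize → 𝒯.meshSize < 1 →
        𝒯.IsRegularQuasiUniform κ τ →
        ∀ (N : ℕ) (x : Fin N → E n), Function.Injective x → range x ⊆ 𝒯.vertices →
          (∀ z : Fin N → ℝ, z ≠ 0 →
            l * 𝒯.meshSize ^ n ≤ rayleigh (𝒯.matrixG x Ω a c₀ α) z ∧
            rayleigh (𝒯.matrixG x Ω a c₀ α) z ≤ u * (𝒯.meshSize ^ n / 𝒯.meshSize ^ 4)) ∧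
          (0 < N →
            (∃ Λ : ℝ, IsLargestEigenvalue (𝒯.matrixMGM x Ω a c₀ α) Λ ∧
              |Λ| ≤ C * 𝒯.meshSize ^ n) ∧
            (∃ Λ : ℝ, IsLargestEigenvalue (𝒯.matrixS x Ω a c₀ α) Λ ∧
              |Λ| ≤ C * 𝒯.meshSize ^ n)) := by
  obtain ⟨A, hA0, hA, hAc⟩ : ∃ A : ℝ, 0 < A ∧
      (∀ᵐ p ∂(volume.restrict Ω), ∀ k l, |a k l p| ≤ A) ∧
      ∀ᵐ p ∂(volume.restrict Ω), |c₀ p| ≤ A := by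
    choose b hb using fun k l => exists_ae_abs_le (hL.memLp_a k l)
    obtain ⟨c, hc⟩ := exists_ae_abs_le hL.memLp_c₀
    refine ⟨1 + |c| + ∑ k, ∑ l, |b k l|, by positivity, ?_, ?_⟩
    · rw [ae_all_iff]; intro k
      rw [ae_all_iff]; intro l
      filter_upwards [hb k l] with p hp
      have h1 : |b k l| ≤ ∑ l, |b k l| :=
        Finset.single_le_sum (f := fun l => |b k l|) (fun _ _ => abs_nonneg _)
          (Finset.mem_univ l)
      have h2 : ∑ l, |b k l| ≤ ∑ k, ∑ l, |b k l| :=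
        Finset.single_le_sum (f := fun k => ∑ l, |b k l|)
          (fun _ _ => Finset.sum_nonneg fun _ _ => abs_nonneg _) (Finset.mem_univ k)
      linarith [le_abs_self (b k l), abs_nonneg c]
    · filter_upwards [hc] with p hp
      have : 0 ≤ ∑ k, ∑ l, |b k l| := by positivity
      linarith [le_abs_self c]
  set ω := volume.real (Metric.ball (0 : E n) 1) with hω
  have hω0 : 0 < ω := volume_real_unitBall_pos n
  set c : ℝ := 1 / (4 * κ * τ) with hc
  have hc0 : 0 < c := by positivity
  set m : ℝ := ω * (c / 4) ^ n / (4 * (n + 1)) with hm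
  have hm0 : 0 < m := by positivity
  set R : ℝ := (n + 1) * (n ^ 2 * A / c ^ 2 + A) * ω with hR
  have hR0 : 0 < R := by positivity
  -- In `u` the two terms bound `M` and `α K M⁻¹ K`; in `C` they bound `M G⁻¹ M` and `S`, the 5
  -- coming from `gamma n ≤ 5`.
  refine ⟨m, ω + α * (R ^ 2 / m), ω + 5 * ω / α, hm0, by positivity, by positivity, ?_⟩
  intro 𝒯 hh hh1 hreg N x hx hxv
  set h := 𝒯.meshSize with hhdef
  set M := 𝒯.massMatrix x with hMdef
  set K := 𝒯.stiffnessMatrix x Ω a c₀ with hKdef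
  set W := 𝒯.lumpedMassMatrix x with hWdef
  set G := 𝒯.matrixG x Ω a c₀ α with hGdef
  have hball : ∀ T ∈ 𝒯.cells, ∃ q, Metric.closedBall q (c * h) ⊆ simplex T := fun T hT =>
    exists_closedBall_subset_simplex hn hκ hτ hreg hh hT
  have hMs : M.IsSymm := massMatrix_isSymm
  have hKs : K.IsSymm := stiffnessMatrix_isSymm hL
  have hM0 : ∀ z, 0 ≤ z ⬝ᵥ M *ᵥ z := massMatrix_nonneg
  have hMge : ∀ z, m * h ^ n * (z ⬝ᵥ z) ≤ z ⬝ᵥ M *ᵥ z := fun z => by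
    convert massMatrix_ge hx hxv (mul_pos hc0 hh) hball z using 2
    rw [hm, mul_div_right_comm c h 4, mul_pow, ← hω]
    ring
  have hmh : 0 < m * h ^ n := by positivity
  have hMpos : ∀ z, z ≠ 0 → 0 < z ⬝ᵥ M *ᵥ z := fun z hz =>
    (mul_pos hmh (dotProduct_self_pos hz)).trans_le (hMge z)
  have hMu : IsUnit M.det := isUnit_det_of_forall_pos hMpos
  have hMW : ∀ z, z ⬝ᵥ M *ᵥ z ≤ z ⬝ᵥ W *ᵥ z := massMatrix_le_lumpedMassMatrix hx
  have hWle : ∀ z, z ⬝ᵥ W *ᵥ z ≤ ω * h ^ n * (z ⬝ᵥ z) := lumpedMassMatrix_le hh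
  have hWu : IsUnit W.det := isUnit_det_of_forall_pos fun z hz => (hMpos z hz).trans_le (hMW z)
  have hGeq : ∀ z, z ⬝ᵥ G *ᵥ z
      = z ⬝ᵥ M *ᵥ z + α * (z ⬝ᵥ (K * M⁻¹ * K) *ᵥ z) := fun z => by
    rw [hGdef, matrixG, add_mulVec, smul_mulVec, dotProduct_add, dotProduct_smul, smul_eq_mul]
  have hMG : ∀ z, z ⬝ᵥ M *ᵥ z ≤ z ⬝ᵥ G *ᵥ z := fun z => by
    rw [hGeq, quadForm_mul_inv_mul hKs hMu]
    exact le_add_of_nonneg_right (mul_nonneg hα.le (hM0 _))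
  have hGu : IsUnit G.det := isUnit_det_of_forall_pos fun z hz => (hMpos z hz).trans_le (hMG z)
  have hrow : ∀ i, ∑ j, |K i j| ≤ R * (h ^ n / h ^ 2) := fun i => by
    refine (sum_abs_stiffnessMatrix_le hx hh hA0.le (mul_pos hc0 hh) hball hA hAc i).trans ?_
    -- As `h < 1`, the zeroth-order term is absorbed into the scale `h⁻²` of the gradient term.
    have h1 : n ^ 2 * A / (c * h) ^ 2 + A ≤ (n ^ 2 * A / c ^ 2 + A) / h ^ 2 := by
      rw [add_div, mul_pow, div_div]
      gcongr
      rw [le_div_iff₀ (by positivity)]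
      exact mul_le_of_le_one_right hA0.le (pow_le_one₀ hh.le hh1.le)
    calc _ ≤ (n + 1) * ((n ^ 2 * A / c ^ 2 + A) / h ^ 2) * (ω * h ^ n) := by gcongr
      _ = _ := by rw [hR]; ring
  have hKle : ∀ z, z ⬝ᵥ (K * M⁻¹ * K) *ᵥ z ≤ R ^ 2 / m * (h ^ n / h ^ 4) * (z ⬝ᵥ z) := fun z => by
    refine (quadForm_mul_inv_mul_le_div hKs hmh hMge hMu z).trans ?_
    rw [div_le_iff₀ hmh]
    refine (dotProduct_mulVec_self_le_of_sum_abs_le hKs (by positivity) hrow z).trans_eq ?_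
    field_simp
  have hGs : G.IsSymm := by
    rw [hGdef, matrixG]
    refine hMs.add (IsSymm.smul ?_ α)
    rw [Matrix.IsSymm, transpose_mul, transpose_mul, transpose_nonsing_inv, hKs.eq, hMs.eq,
      Matrix.mul_assoc]
  have hMle : ∀ z, z ⬝ᵥ M *ᵥ z ≤ ω * h ^ n * (z ⬝ᵥ z) := fun z => (hMW z).trans (hWle z)
  have hMGM : ∀ z, z ⬝ᵥ (M * G⁻¹ * M) *ᵥ z ≤ z ⬝ᵥ M *ᵥ z :=
    quadForm_mul_inv_mul_le hMs hGu hM0 hMG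
  have hzz : ∀ {ι : Type} [Fintype ι] (z : ι → ℝ), 0 ≤ z ⬝ᵥ z := fun z => by
    simpa using dotProduct_star_self_nonneg z
  refine ⟨fun z hz => ⟨?_, ?_⟩, fun hN => ⟨?_, ?_⟩⟩
  · rw [rayleigh, le_div_iff₀ (dotProduct_self_pos hz)]
    exact (hMge z).trans (hMG z)
  · rw [rayleigh, div_le_iff₀ (dotProduct_self_pos hz)]
    change z ⬝ᵥ G *ᵥ z ≤ _
    rw [hGeq]
    have h1 : h ^ n ≤ h ^ n / h ^ 4 :=
      le_div_self (by positivity) (by positivity) (pow_le_one₀ hh.le hh1.le)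
    have h2 : ω * h ^ n * (z ⬝ᵥ z) ≤ ω * (h ^ n / h ^ 4) * (z ⬝ᵥ z) := by
      have := hzz z
      gcongr
    have h3 := mul_le_mul_of_nonneg_left (hKle z) hα.le
    linarith [hMle z]
  · have : Nonempty (Fin N) := ⟨⟨0, hN⟩⟩
    change ∃ Λ, IsLargestEigenvalue (M * G⁻¹ * M) Λ ∧ _
    refine exists_isLargestEigenvalue _ (fun z => ?_) (exists_nonneg_eigenvalue ?_ fun z => ?_)
    · refine ((hMGM z).trans (hMle z)).trans (mul_le_mul_of_nonneg_right ?_ (hzz z))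
      gcongr
      exact le_add_of_nonneg_right (by positivity)
    · rw [Matrix.IsSymm, transpose_mul, transpose_mul, transpose_nonsing_inv, hMs.eq, hGs.eq,
        Matrix.mul_assoc]
    · rw [quadForm_mul_inv_mul hMs hGu]
      exact (hM0 _).trans (hMG _)
  · have hγ0 : 0 < gamma n := by rw [gamma]; split_ifs <;> norm_num
    have hγ5 : gamma n ≤ 5 := by rw [gamma]; split_ifs <;> norm_num
    have hωh : 0 < ω * h ^ n := by positivity
    refine exists_isLargestEigenvalue _ (fun z => ?_) ?_
    -- Since `M G⁻¹ M - M ≤ 0`, this block is at most `W`; the 5 only matches the bound of the last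
    -- block.
    · have hP : ∀ z, z ⬝ᵥ (M * G⁻¹ * M + W - M) *ᵥ z ≤ 5 * (ω * h ^ n) * (z ⬝ᵥ z) := fun z => by
        rw [sub_mulVec, add_mulVec, dotProduct_sub, dotProduct_add]
        nlinarith [hMGM z, hWle z, mul_nonneg hωh.le (hzz z)]
      have hQ : ∀ z, z ⬝ᵥ (gamma n • (M * W⁻¹ * M)) *ᵥ z ≤ 5 * (ω * h ^ n) * (z ⬝ᵥ z) := fun z => by
        rw [smul_mulVec, dotProduct_smul, smul_eq_mul, mul_assoc (5 : ℝ)]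
        have h1 := (quadForm_mul_inv_mul_le hMs hWu hM0 hMW z).trans (hMle z)
        exact (mul_le_mul_of_nonneg_left h1 hγ0.le).trans
          (mul_le_mul_of_nonneg_right hγ5 (mul_nonneg hωh.le (hzz z)))
      have h0 : ∀ z : Fin N → ℝ,
          z ⬝ᵥ (0 : Matrix (Fin N) (Fin N) ℝ) *ᵥ z ≤ 5 * (ω * h ^ n) * (z ⬝ᵥ z) := fun z => by
        rw [zero_mulVec, dotProduct_zero]
        exact mul_nonneg (by positivity) (hzz z)
      have hS := dotProduct_fromBlocks_zero_mulVec_le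
        (dotProduct_fromBlocks_zero_mulVec_le hP h0) hQ z
      rw [matrixS, smul_mulVec, dotProduct_smul, smul_eq_mul]
      refine (mul_le_mul_of_nonneg_left hS (by positivity)).trans ?_
      have h2 : 1 / α * (5 * (ω * h ^ n) * (z ⬝ᵥ z)) = 5 * ω / α * h ^ n * (z ⬝ᵥ z) := by ring
      rw [h2]
      refine mul_le_mul_of_nonneg_right ?_ (hzz z)
      gcongr
      exact le_add_of_nonneg_left hω0.le
    -- The zero middle block supplies the eigenvalue 0, so the largest eigenvalue of `S` is
    -- nonnegative.
    · refine ⟨0, le_rfl, Sum.elim (Sum.elim 0 1) 0, fun h0 => ?_, ?_⟩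
      · simpa using congrFun h0 (Sum.inl (Sum.inr ⟨0, hN⟩))
      · rw [matrixS, smul_mulVec, fromBlocks_mulVec, Sum.elim_comp_inl, Sum.elim_comp_inr,
          fromBlocks_mulVec]
        ext ((i | i) | i) <;> simp

end Triangulation

end FEM

theorem mainTheorem5 (n : ℕ) (hn : n = 2 ∨ n = 3)
    (Ω : Set (FEM.E n)) (hΩo : IsOpen Ω) (hΩc : Convex ℝ Ω) (hΩb : Bornology.IsBounded Ω)
    (a : Fin n → Fin n → FEM.E n → ℝ) (c₀ : FEM.E n → ℝ) (θ : ℝ)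
    (hL : FEM.IsElliptic Ω a c₀ θ)
    (α : ℝ) (hα : 0 < α) (κ τ : ℝ) (hκ : 0 < κ) (hτ : 0 < τ) :
    ∃ l₁ l₂ u₁ u₂ C h₀ : ℝ, 0 < l₁ ∧ 0 < l₂ ∧ 0 < u₁ ∧ 0 < u₂ ∧ 0 < C ∧ 0 < h₀ ∧
      ∀ (𝒯 : FEM.Triangulation n) (h : ℝ), 𝒯.meshSize = h → 0 < h → h < h₀ →
        𝒯.IsRegularQuasiUniform κ τ → 𝒯.domain ⊆ Ω →
        ∀ (N : ℕ) (x : Fin N → FEM.E n), Function.Injective x →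
          (Set.range x = 𝒯.interiorVertices ∨ Set.range x = 𝒯.vertices) →
          (∀ z : Fin N → ℝ, z ≠ 0 →
            (n = 2 →
              l₁ * h ^ 2 ≤ FEM.rayleigh (𝒯.matrixG x Ω a c₀ α) z ∧
              FEM.rayleigh (𝒯.matrixG x Ω a c₀ α) z ≤ u₁ * (1 / h ^ 2)) ∧
            (n = 3 →
              l₂ * h ^ 3 ≤ FEM.rayleigh (𝒯.matrixG x Ω a c₀ α) z ∧
              FEM.rayleigh (𝒯.matrixG x Ω a c₀ α) z ≤ u₂ * (1 / h))) ∧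
          (0 < N →
            (∃ Λ : ℝ, FEM.IsLargestEigenvalue (𝒯.matrixMGM x Ω a c₀ α) Λ ∧
              (n = 2 → |Λ| ≤ C * h ^ 2) ∧ (n = 3 → |Λ| ≤ C * h ^ 3)) ∧
            (∃ Λ : ℝ, FEM.IsLargestEigenvalue (𝒯.matrixS x Ω a c₀ α) Λ ∧
              (n = 2 → |Λ| ≤ C * h ^ 2) ∧ (n = 3 → |Λ| ≤ C * h ^ 3))) := by
  have hn0 : 0 < n := by omega
  obtain ⟨l, u, C, hl, hu, hC, H⟩ :=
    FEM.Triangulation.exists_matrix_bounds hn0 hL hα hκ hτ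
  -- The threshold `h₀ = 1` is what lets lower powers of `1 / h` be absorbed into higher ones.
  refine ⟨l, l, u, u, C, 1, hl, hl, hu, hu, hC, one_pos, ?_⟩
  rintro 𝒯 h rfl hh hh1 hreg - N x hx hxr
  have hxv : range x ⊆ 𝒯.vertices := by
    rcases hxr with hr | hr
    · rw [hr]; exact fun v hv => hv.1
    · exact hr.subset
  obtain ⟨H1, H2⟩ := H 𝒯 hh hh1 hreg N x hx hxv
  refine ⟨fun z hz => ⟨?_, ?_⟩, fun hN => ?_⟩
  · rintro rfl
    refine ⟨(H1 z hz).1, (H1 z hz).2.trans_eq ?_⟩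
    field_simp
  · rintro rfl
    refine ⟨(H1 z hz).1, (H1 z hz).2.trans_eq ?_⟩
    field_simp
  · obtain ⟨⟨Λ, hΛ, hb⟩, Λ', hΛ', hb'⟩ := H2 hN
    exact ⟨⟨Λ, hΛ, by rintro rfl; exact hb, by rintro rfl; exact hb⟩,
      Λ', hΛ', by rintro rfl; exact hb', by rintro rfl; exact hb'⟩
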